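/- Equip the Cantor space $2^\omega$ of infinite binary sequences with the metric given by $d(x,x)=0$ and $d(x,y)=2^{-n}$ for $x\neq y$, where $n$ is least such that $x(n)\neq y(n)$. Let $Q$ be a locally countable Borel quasi-order on $2^\omega$, that is, a reflexive and transitive relation $\leq_Q$ on $2^\omega$ that is a Borel subset of $2^\omega\times 2^\omega$ and such that $\{x\in 2^\omega : x\leq_Q y\}$ is countable for every $y\in 2^\omega$. Then there is a closed set $B\subseteq 2^\omega$ of Hausdorff dimension $1$ (with respect to $d$) that is a $Q$-antichain, i.e. $x\not\leq_Q y$ for all distinct $x,y\in B$. -/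

import Mathlib

/-- The metric on the Cantor space `2^ω`, realized as `ℕ → Bool`: for `x ≠ y`, `dist x y = 2⁻ⁿ`
where `n` is the least index with `x n ≠ y n`. Its topology is the product topology. -/
noncomputable instance cantorMetricSpace : MetricSpace (ℕ → Bool) :=
  PiNat.metricSpaceOfDiscreteUniformity (fun _ => rfl)

theorem cantor_dist_eq {x y : ℕ → Bool} {n : ℕ} (hn : x n ≠ y n) (hlt : ∀ i < n, x i = y i) :
    dist x y = (2 : ℝ)⁻¹ ^ n := by
  have hxy : x ≠ y := fun h => hn (congrFun h n)
  have h1 : PiNat.firstDiff x y = n := by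
    apply le_antisymm
    · by_contra! h
      exact hn (PiNat.apply_eq_of_lt_firstDiff h)
    · by_contra! h
      exact PiNat.apply_firstDiff_ne hxy (hlt _ h)
  have h2 := PiNat.dist_eq_of_ne hxy
  rw [h1, one_div] at h2
  exact h2

/-- A locally countable Borel quasi-order on the Cantor space; `Q x y` is read `x ≤_Q y`. -/
structure IsLocallyCountableBorelQuasiOrder (Q : (ℕ → Bool) → (ℕ → Bool) → Prop) : Prop where
  refl : ∀ x, Q x x
  trans : ∀ x y z, Q x y → Q y z → Q x z
  borel : MeasurableSet {p : (ℕ → Bool) × (ℕ → Bool) | Q p.1 p.2}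
  locallyCountable : ∀ y, {x | Q x y}.Countable

/-!
Fix an infinite set `D` of positions of density zero. A hash function `ω` turns a sequence `z` into
a codeword: each bit at a position in `D` is overwritten by a check bit, the value of `ω` at the
preceding data bits, those at positions outside `D`. Take `ω` random and `z` fixed. The codeword `y`
of `z` only involves the values of `ω` at prefixes of `z`. Once these are fixed, any of the
countably many other `x` below `y` is either not a codeword or has different data bits, and in the
latter case its check bits past the first difference are independent fair coins, so that almost
surely `x` is not a codeword. The pairs `(z, ω)` for which some other codeword lies below that of
`z` form an analytic set, which is universally measurable, so by Fubini some `ω` works for almost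
every `z`. The codewords of a compact set of positive measure of such `z` are a closed antichain,
and it has dimension `1` by the mass distribution principle because `D` has density zero.
-/

open MeasureTheory Set Filter Topology
open scoped ENNReal NNReal

section AnalyticSet

theorem exists_lt_measure_image_inter_le {α X : Type*} [MeasurableSpace X] {μ : Measure X}
    {f : α → X} {A : Set α} {c : ℝ≥0∞} (g : α → ℕ) (h : c < μ (f '' A)) :
    ∃ m, c < μ (f '' (A ∩ {x | g x ≤ m})) := by
  have hcover : f '' A = ⋃ m, f '' (A ∩ {x | g x ≤ m}) := by
    rw [← image_iUnion, ← inter_iUnion, iUnion_eq_univ_iff.2 fun x => ⟨g x, le_refl (g x)⟩,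
      inter_univ]
  have hmono : Monotone fun m => f '' (A ∩ {x | g x ≤ m}) := fun a b hab =>
    image_mono (inter_subset_inter_right _ fun _ hx => le_trans hx hab)
  rw [hcover, hmono.measure_iUnion] at h
  exact lt_iSup_iff.1 h

theorem exists_forall_lt_measure_image_le {X : Type*} [MeasurableSpace X] {μ : Measure X}
    {f : (ℕ → ℕ) → X} {c : ℝ≥0∞} (h : c < μ (range f)) :
    ∃ k : ℕ → ℕ, ∀ n, c < μ (f '' {x | ∀ i < n, x i ≤ k i}) := by
  choose! g hg using fun (n : ℕ) (A : Set (ℕ → ℕ)) =>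
    exists_lt_measure_image_inter_le (μ := μ) (f := f) (A := A) (c := c) fun x => x n
  let A : ℕ → Set (ℕ → ℕ) := fun n => n.rec univ fun n A => A ∩ {x | x n ≤ g n A}
  have hA : ∀ n, c < μ (f '' A n) := fun n => by
    induction n with
    | zero => rwa [← image_univ] at h
    | succ n ih => exact hg n _ ih
  have hA_eq : ∀ n, A n = {x | ∀ i < n, x i ≤ g i (A i)} := fun n => by
    induction n with
    | zero => simp [A]
    | succ n ih =>
      ext x
      simp only [Nat.forall_lt_succ_right, mem_ofPred_eq]
      exact and_congr_left fun _ => Set.ext_iff.1 ih x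
  exact ⟨fun i => g i (A i), fun n => hA_eq n ▸ hA n⟩

theorem exists_forall_lt_le_subset_of_pi_Iic_subset {k : ℕ → ℕ} {V : Set (ℕ → ℕ)} (hV : IsOpen V)
    (hkV : univ.pi (fun i => Iic (k i)) ⊆ V) : ∃ n, {x | ∀ i < n, x i ≤ k i} ⊆ V := by
  let := PiNat.metricSpaceNatNat
  have hcompact : IsCompact (univ.pi fun i => Iic (k i)) :=
    isCompact_univ_pi fun i => (finite_Iic (k i)).isCompact
  obtain ⟨δ, hδ, hδV⟩ := hcompact.exists_thickening_subset_open hV hkV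
  obtain ⟨n, hn⟩ := exists_pow_lt_of_lt_one hδ (one_half_lt_one (α := ℝ))
  refine ⟨n, fun x hx => hδV (Metric.mem_thickening_iff.2
    ⟨fun i => min (x i) (k i), fun i _ => min_le_right (x i) (k i), lt_of_le_of_lt ?_ hn⟩)⟩
  exact PiNat.mem_cylinder_iff_dist_le.1 fun i hi => (min_eq_left (hx i hi)).symm

theorem exists_isCompact_subset_le_measure_of_analyticSet {X : Type*} [TopologicalSpace X]
    [MeasurableSpace X] {μ : Measure X} [μ.OuterRegular] {A : Set X} (hA : AnalyticSet A)
    {c : ℝ≥0∞} (hc : c < μ A) : ∃ K ⊆ A, IsCompact K ∧ c ≤ μ K := by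
  rw [AnalyticSet] at hA
  obtain rfl | ⟨f, hf, rfl⟩ := hA
  · simp at hc
  obtain ⟨k, hk⟩ := exists_forall_lt_measure_image_le hc
  refine ⟨f '' univ.pi fun i => Iic (k i), image_subset_range _ _,
    (isCompact_univ_pi fun i => (finite_Iic (k i)).isCompact).image hf, ?_⟩
  rw [measure_eq_iInf_isOpen]
  refine le_iInf₂ fun U hKU => le_iInf fun hU => ?_
  obtain ⟨n, hn⟩ := exists_forall_lt_le_subset_of_pi_Iic_subset (hU.preimage hf)
    (image_subset_iff.1 hKU)
  exact (hk n).le.trans (measure_mono (image_subset_iff.2 hn))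

theorem nullMeasurableSet_of_analyticSet {X : Type*} [TopologicalSpace X] [T2Space X]
    [MeasurableSpace X] [OpensMeasurableSpace X] {μ : Measure X} [IsFiniteMeasure μ]
    [μ.OuterRegular] {A : Set X} (hA : AnalyticSet A) : NullMeasurableSet A μ := by
  rcases eq_or_ne (μ A) 0 with h0 | h0
  · exact NullMeasurableSet.of_null h0
  obtain ⟨u, -, hu, hut⟩ := exists_seq_strictMono_tendsto' (pos_iff_ne_zero.2 h0)
  choose K hKA hK huK using fun n =>
    exists_isCompact_subset_le_measure_of_analyticSet hA (hu n).2
  have hKmeas : MeasurableSet (⋃ n, K n) := .iUnion fun n => (hK n).measurableSet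
  have hle : μ A ≤ μ (⋃ n, K n) :=
    le_of_tendsto' hut fun n => (huK n).trans (measure_mono (subset_iUnion _ _))
  exact hKmeas.nullMeasurableSet.congr (ae_eq_of_subset_of_measure_ge (iUnion_subset hKA) hle
    hKmeas.nullMeasurableSet (measure_ne_top μ _))

instance {ι : Type*} [Countable ι] : PolishSpace (ι → Bool) := by
  let := TopologicalSpace.metrizableSpaceMetric (ι → Bool)
  infer_instance

end AnalyticSet

section ProductMeasure

theorem measure_prod_null_of_ae_null_of_nullMeasurableSet {X Y : Type*} [MeasurableSpace X]
    [MeasurableSpace Y] {μ : Measure X} {ν : Measure Y} [SFinite ν] {s : Set (X × Y)}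
    (hs : NullMeasurableSet s (μ.prod ν)) (h : ∀ᵐ x ∂μ, ν (Prod.mk x ⁻¹' s) = 0) :
    μ.prod ν s = 0 := by
  obtain ⟨t, hts, ht, hae⟩ := hs.exists_measurable_subset_ae_eq
  rw [← measure_congr hae]
  refine Measure.measure_prod_null_of_ae_null ht ?_
  filter_upwards [h] with x hx
  exact measure_mono_null (preimage_mono hts) hx

variable {ι : Type*} {X : ι → Type*} [∀ i, MeasurableSpace (X i)]

theorem measurable_set_piecewise (S : Set ι) [DecidablePred (· ∈ S)] :
    Measurable fun p : (∀ i, X i) × (∀ i, X i) => S.piecewise p.1 p.2 := by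
  refine measurable_pi_lambda _ fun i => ?_
  by_cases hi : i ∈ S
  · simp only [piecewise_eq_of_mem _ _ _ hi]
    fun_prop
  · simp only [piecewise_eq_of_notMem _ _ _ hi]
    fun_prop

theorem measurePreserving_piecewise_infinitePi (μ : ∀ i, Measure (X i))
    [∀ i, IsProbabilityMeasure (μ i)] (S : Set ι) [DecidablePred (· ∈ S)] :
    MeasurePreserving (fun p : (∀ i, X i) × (∀ i, X i) => S.piecewise p.1 p.2)
      ((Measure.infinitePi μ).prod (Measure.infinitePi μ)) (Measure.infinitePi μ) := by
  refine ⟨measurable_set_piecewise S, Measure.eq_infinitePi μ fun s t ht => ?_⟩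
  have hpre : (fun p : (∀ i, X i) × (∀ i, X i) => S.piecewise p.1 p.2) ⁻¹' (s : Set ι).pi t =
      (({i ∈ s | i ∈ S} : Finset ι) : Set ι).pi t ×ˢ
        (({i ∈ s | i ∉ S} : Finset ι) : Set ι).pi t := by
    ext p
    simp only [mem_preimage, Set.mem_pi, mem_prod, Finset.coe_filter, mem_ofPred_eq, and_imp,
      ← forall_and]
    refine forall₂_congr fun i _ => ?_
    by_cases hi : i ∈ S <;> simp [hi]
  rw [Measure.map_apply (measurable_set_piecewise S) (.pi s.countable_toSet fun i _ => ht i),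
    hpre, Measure.prod_prod, Measure.infinitePi_pi _ fun i _ => ht i,
    Measure.infinitePi_pi _ fun i _ => ht i, Finset.prod_filter_mul_prod_filter_not]

theorem infinitePi_null_of_forall_piecewise_null (μ : ∀ i, Measure (X i))
    [∀ i, IsProbabilityMeasure (μ i)] (S : Set ι) [DecidablePred (· ∈ S)] {A : Set (∀ i, X i)}
    (hA : NullMeasurableSet A (Measure.infinitePi μ))
    (h : ∀ a, Measure.infinitePi μ {b | S.piecewise a b ∈ A} = 0) :
    Measure.infinitePi μ A = 0 := by
  have hmp := measurePreserving_piecewise_infinitePi μ S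
  rw [← hmp.measure_preimage hA]
  exact measure_prod_null_of_ae_null_of_nullMeasurableSet
    (hA.preimage hmp.quasiMeasurePreserving) (.of_forall h)

end ProductMeasure

section Coin

/-- The law of independent fair coin tosses indexed by `ι`. -/
noncomputable def coinMeasure (ι : Type*) : Measure (ι → Bool) :=
  Measure.infinitePi fun _ => (PMF.uniformOfFintype Bool).toMeasure

instance (ι : Type*) : IsProbabilityMeasure (coinMeasure ι) := by
  unfold coinMeasure
  infer_instance

variable {ι : Type*}

theorem coinMeasure_pi_singleton (s : Finset ι) (x : ι → Bool) :
    coinMeasure ι ((s : Set ι).pi fun i => {x i}) = 2⁻¹ ^ s.card := by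
  rw [coinMeasure, Measure.infinitePi_pi _ fun i _ => measurableSet_singleton _]
  simp

theorem coinMeasure_pi_singleton_of_infinite {S : Set ι} (hS : S.Infinite) (x : ι → Bool) :
    coinMeasure ι (S.pi fun i => {x i}) = 0 := by
  refine le_antisymm (ge_of_tendsto' (ENNReal.tendsto_pow_atTop_nhds_zero_of_lt_one
    (r := 2⁻¹) (by norm_num)) fun n => ?_) zero_le
  obtain ⟨s, hs, rfl⟩ := hS.exists_subset_card_eq n
  rw [← coinMeasure_pi_singleton s x]
  exact measure_mono (pi_mono' (fun _ _ => subset_rfl) hs)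

end Coin

section Dimension

theorem le_dimH_of_measure_closedEBall_le {X : Type*} [EMetricSpace X] [MeasurableSpace X]
    [BorelSpace X] {ν : Measure X} {B : Set X} (hB : ν B ≠ 0) {s : ℝ≥0}
    (h : ∀ᶠ r in 𝓝[>] (0 : ℝ≥0∞), ∀ x, ν (Metric.closedEBall x r) ≤ r ^ (s : ℝ)) :
    (s : ℝ≥0∞) ≤ dimH B := by
  obtain ⟨ε, hε, hball⟩ := (mem_nhdsGT_iff_exists_Ioo_subset' ENNReal.zero_lt_top).1 h
  obtain ⟨δ, hδ, hδε⟩ := exists_between (mem_Ioi.1 hε)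
  have hle : ν ≤ Measure.hausdorffMeasure s := by
    refine Measure.le_hausdorffMeasure s ν δ hδ fun t ht => ?_
    obtain rfl | ⟨x, hx⟩ := t.eq_empty_or_nonempty
    · simp
    have hdiam : Metric.ediam t < ε := ht.trans_lt hδε
    have : (𝓝[>] Metric.ediam t).NeBot := nhdsGT_neBot_of_exists_gt ⟨ε, hdiam⟩
    refine ge_of_tendsto (ENNReal.continuous_rpow_const.tendsto _ |>.mono_left
      (nhdsWithin_le_nhds (s := Ioi (Metric.ediam t)))) ?_
    filter_upwards [Ioo_mem_nhdsGT hdiam] with r hr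
    exact (measure_mono fun y hy => (Metric.edist_le_ediam_of_mem hy hx).trans hr.1.le).trans
      (hball ⟨zero_le.trans_lt hr.1, hr.2⟩ x)
  exact le_dimH_of_hausdorffMeasure_ne_zero fun h0 => hB (le_antisymm (h0 ▸ hle B) zero_le)

theorem cantor_edist_eq_of_ne {x y : ℕ → Bool} (h : x ≠ y) :
    edist x y = 2⁻¹ ^ PiNat.firstDiff x y := by
  rw [edist_dist, cantor_dist_eq (PiNat.apply_firstDiff_ne h)
    fun _ => PiNat.apply_eq_of_lt_firstDiff, ENNReal.ofReal_pow (by norm_num),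
    ENNReal.ofReal_inv_of_pos (by norm_num), ENNReal.ofReal_ofNat]

theorem cantor_edist_le_of_mem_cylinder {x y : ℕ → Bool} {n : ℕ} (h : x ∈ PiNat.cylinder y n) :
    edist x y ≤ 2⁻¹ ^ n := by
  obtain rfl | hxy := eq_or_ne x y
  · simp
  rw [cantor_edist_eq_of_ne hxy]
  exact pow_le_pow_right_of_le_one' (by norm_num)
    ((PiNat.mem_cylinder_iff_le_firstDiff hxy n).1 h)

theorem exists_cantor_closedEBall_subset_cylinder {r : ℝ≥0∞} (hr : r ≠ 0) :
    ∃ n, 2⁻¹ ^ n ≤ r ∧ ∀ x : ℕ → Bool, Metric.closedEBall x r ⊆ PiNat.cylinder x n := by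
  classical
  have hex : ∃ n, (2⁻¹ : ℝ≥0∞) ^ n ≤ r := (ENNReal.exists_inv_two_pow_lt hr).imp fun _ => le_of_lt
  refine ⟨Nat.find hex, Nat.find_spec hex, fun x y hy i hi => ?_⟩
  by_contra hne
  have hyx : y ≠ x := ne_of_apply_ne (· i) hne
  have hlt : PiNat.firstDiff y x < Nat.find hex :=
    (not_lt.1 fun h => hne (PiNat.apply_eq_of_lt_firstDiff h)).trans_lt hi
  exact Nat.find_min hex hlt (cantor_edist_eq_of_ne hyx ▸ hy)

theorem le_dimH_of_measure_cylinder_le {ν : Measure (ℕ → Bool)} {B : Set (ℕ → Bool)}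
    (hB : ν B ≠ 0) {s : ℝ≥0}
    (h : ∀ᶠ n in atTop, ∀ x, ν (PiNat.cylinder x n) ≤ (2⁻¹ ^ n) ^ (s : ℝ)) :
    (s : ℝ≥0∞) ≤ dimH B := by
  obtain ⟨N, hN⟩ := eventually_atTop.1 h
  refine le_dimH_of_measure_closedEBall_le hB ?_
  filter_upwards [Ioo_mem_nhdsGT (ENNReal.pow_pos (a := 2⁻¹) (by norm_num) N)]
    with r hr x
  obtain ⟨n, hnr, hn⟩ := exists_cantor_closedEBall_subset_cylinder hr.1.ne'
  have hNn : N ≤ n := by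
    by_contra! hlt
    exact (hnr.trans_lt hr.2).not_ge (pow_le_pow_right_of_le_one' (by norm_num) hlt.le)
  calc ν (Metric.closedEBall x r) ≤ ν (PiNat.cylinder x n) := measure_mono (hn x)
    _ ≤ (2⁻¹ ^ n) ^ (s : ℝ) := hN n hNn x
    _ ≤ r ^ (s : ℝ) := ENNReal.rpow_le_rpow hnr s.coe_nonneg

theorem cantor_hausdorffMeasure_one_univ_le :
    Measure.hausdorffMeasure 1 (univ : Set (ℕ → Bool)) ≤ 1 := by
  let fiber : ∀ n, (Fin n → Bool) → Set (ℕ → Bool) := fun n σ => (fun x i => x i.1) ⁻¹' {σ}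
  have hdiam : ∀ n σ, Metric.ediam (fiber n σ) ≤ 2⁻¹ ^ n := fun n σ =>
    Metric.ediam_le fun x hx y hy => cantor_edist_le_of_mem_cylinder fun i hi =>
      (congrFun hx ⟨i, hi⟩).trans (congrFun hy ⟨i, hi⟩).symm
  refine (Measure.hausdorffMeasure_le_liminf_sum (l := atTop) 1 univ _
    (ENNReal.tendsto_pow_atTop_nhds_zero_of_lt_one (by norm_num)) fiber (.of_forall hdiam)
    (.of_forall fun n x _ => mem_iUnion.2 ⟨_, rfl⟩)).trans ?_
  refine liminf_le_of_le (by isBoundedDefault) fun b hb => ?_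
  obtain ⟨n, hn⟩ := hb.exists
  calc b ≤ ∑ σ, Metric.ediam (fiber n σ) ^ (1 : ℝ) := hn
    _ ≤ ∑ _σ : Fin n → Bool, (2⁻¹ : ℝ≥0∞) ^ n := by
      simp only [ENNReal.rpow_one]
      exact Finset.sum_le_sum fun σ _ => hdiam n σ
    _ = 1 := by simp [← mul_pow, ENNReal.mul_inv_cancel]

theorem cantor_dimH_le_one (s : Set (ℕ → Bool)) : dimH s ≤ 1 :=
  (dimH_mono (subset_univ s)).trans <| dimH_le_of_hausdorffMeasure_ne_top (d := 1) <|
    ne_top_of_le_ne_top ENNReal.one_ne_top cantor_hausdorffMeasure_one_univ_le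

end Dimension

section RandomCode

variable (D : Set ℕ) [DecidablePred (· ∈ D)]

/-- The first `n` bits of `x`, with those at positions in `D` replaced by `false`; the length of
the list records `n`. -/
def dataPrefix (x : ℕ → Bool) (n : ℕ) : List Bool :=
  PiNat.res (D.piecewise (fun _ => false) x) n

/-- Keep the data bits of `z`, those at positions outside `D`, and overwrite each bit at a position
in `D` by the check bit which the hash function `ω` assigns to the preceding data bits. -/
def encode (ω : List Bool → Bool) (z : ℕ → Bool) : ℕ → Bool :=
  D.piecewise (fun n => ω (dataPrefix D z n)) z

/-- The sequences all of whose bits at positions in `D` are the check bits required by `ω`; this is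
the range of `encode D ω`. -/
def codewords (ω : List Bool → Bool) : Set (ℕ → Bool) :=
  {x | ∀ n ∈ D, x n = ω (dataPrefix D x n)}

variable {D} {ω ω' : List Bool → Bool} {x y z : ℕ → Bool} {m n : ℕ}

theorem dataPrefix_eq_iff :
    dataPrefix D x m = dataPrefix D y n ↔ m = n ∧ ∀ i < n, i ∉ D → x i = y i := by
  have hlen : dataPrefix D x m = dataPrefix D y n → m = n := fun h => by
    simpa only [dataPrefix, PiNat.res_length] using congrArg List.length h
  refine ⟨fun h => ?_, ?_⟩
  · obtain rfl := hlen h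
    refine ⟨rfl, fun i hi hiD => ?_⟩
    simpa [hiD] using PiNat.res_eq_res.1 h hi
  · rintro ⟨rfl, h⟩
    refine PiNat.res_eq_res.2 fun i hi => ?_
    by_cases hiD : i ∈ D
    · simp [hiD]
    · simpa [hiD] using h i hi hiD

theorem dataPrefix_injective (x : ℕ → Bool) : Function.Injective (dataPrefix D x) :=
  fun _ _ h => (dataPrefix_eq_iff.1 h).1

theorem encode_apply_of_mem (hn : n ∈ D) : encode D ω z n = ω (dataPrefix D z n) :=
  piecewise_eq_of_mem _ _ _ hn

theorem encode_apply_of_notMem (hn : n ∉ D) : encode D ω z n = z n :=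
  piecewise_eq_of_notMem _ _ _ hn

theorem encode_congr_hash (h : EqOn ω ω' (range (dataPrefix D z))) :
    encode D ω z = encode D ω' z := by
  ext n
  by_cases hn : n ∈ D
  · rw [encode_apply_of_mem hn, encode_apply_of_mem hn, h (mem_range_self n)]
  · rw [encode_apply_of_notMem hn, encode_apply_of_notMem hn]

theorem encode_mem_codewords : encode D ω z ∈ codewords D ω := fun n hn => by
  rw [encode_apply_of_mem hn,
    dataPrefix_eq_iff.2 ⟨rfl, fun _ _ hi => (encode_apply_of_notMem (ω := ω) hi).symm⟩]

theorem eq_of_mem_codewords (hx : x ∈ codewords D ω) (hy : y ∈ codewords D ω)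
    (h : ∀ n ∉ D, x n = y n) : x = y := by
  ext n
  by_cases hn : n ∈ D
  · rw [hx n hn, hy n hn, dataPrefix_eq_iff.2 ⟨rfl, fun i _ => h i⟩]
  · rw [h n hn]

theorem continuous_apply_dataPrefix (n : ℕ) :
    Continuous fun p : (List Bool → Bool) × (ℕ → Bool) => p.1 (dataPrefix D p.2 n) := by
  refine continuous_iff_continuousAt.2 fun p => ?_
  have hc : Continuous fun q : (List Bool → Bool) × (ℕ → Bool) => q.1 (dataPrefix D p.2 n) := by
    fun_prop
  refine hc.continuousAt.congr ?_
  have hcyl : Prod.snd ⁻¹' PiNat.cylinder p.2 n ∈ 𝓝 p :=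
    ((PiNat.isOpen_cylinder _ p.2 n).preimage continuous_snd).mem_nhds (PiNat.self_mem_cylinder _ _)
  filter_upwards [hcyl] with q hq
  rw [dataPrefix_eq_iff.2 ⟨rfl, fun i hi _ => (hq i hi).symm⟩]

theorem continuous_encode :
    Continuous fun p : (List Bool → Bool) × (ℕ → Bool) => encode D p.1 p.2 := by
  refine continuous_pi fun n => ?_
  by_cases hn : n ∈ D
  · simp only [encode_apply_of_mem hn]
    exact continuous_apply_dataPrefix n
  · simp only [encode_apply_of_notMem hn]
    fun_prop

theorem isClosed_codewords :
    IsClosed {p : (List Bool → Bool) × (ℕ → Bool) | p.2 ∈ codewords D p.1} := by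
  have : {p : (List Bool → Bool) × (ℕ → Bool) | p.2 ∈ codewords D p.1} =
      ⋂ n ∈ D, {p | p.2 n = p.1 (dataPrefix D p.2 n)} := by
    ext p
    simp [codewords]
  rw [this]
  exact isClosed_biInter fun n _ => isClosed_eq (by fun_prop) (continuous_apply_dataPrefix n)

/-- If `x` is separated from `z` by a data bit, then from that bit on the check bits of `x` are read
off entries of the hash function that do not influence `encode D ω z`. -/
theorem coinMeasure_mem_codewords_piecewise (hD : D.Infinite) (hn : n ∉ D) (hxz : x n ≠ z n)
    [DecidablePred (· ∈ range (dataPrefix D z))] (ω : List Bool → Bool) :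
    coinMeasure (List Bool) {τ | x ∈ codewords D ((range (dataPrefix D z)).piecewise ω τ)} = 0 := by
  have hinf : (dataPrefix D x '' (D \ Iic n)).Infinite :=
    (hD.sdiff (finite_Iic n)).image (dataPrefix_injective x).injOn
  refine measure_mono_null ?_ (coinMeasure_pi_singleton_of_infinite hinf fun l => x l.length)
  rintro τ hτ _ ⟨m, ⟨hmD, hnm⟩, rfl⟩
  have hfresh : dataPrefix D x m ∉ range (dataPrefix D z) := by
    rintro ⟨k, hk⟩
    exact hxz ((dataPrefix_eq_iff.1 hk).2 n (not_le.1 hnm) hn).symm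
  have hbit := hτ m hmD
  rw [piecewise_eq_of_notMem _ _ _ hfresh] at hbit
  simp only [dataPrefix, PiNat.res_length] at hbit ⊢
  exact hbit.symm

section Relation

variable {Q : (ℕ → Bool) → (ℕ → Bool) → Prop}

variable (D Q) in
/-- The pairs `(z, ω)` of a sequence and a hash function such that the codeword `encode D ω z` has
another codeword below it in `Q`. -/
def dominatedPairs : Set ((ℕ → Bool) × (List Bool → Bool)) :=
  {p | ∃ x ∈ codewords D p.2, x ≠ encode D p.2 p.1 ∧ Q x (encode D p.2 p.1)}

theorem analyticSet_dominatedPairs (hQ : MeasurableSet {p : (ℕ → Bool) × (ℕ → Bool) | Q p.1 p.2}) :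
    AnalyticSet (dominatedPairs D Q) := by
  have henc : Continuous fun t : ((ℕ → Bool) × (List Bool → Bool)) × (ℕ → Bool) =>
      encode D t.1.2 t.1.1 :=
    continuous_encode.comp (by fun_prop : Continuous fun t :
      ((ℕ → Bool) × (List Bool → Bool)) × (ℕ → Bool) => (t.1.2, t.1.1))
  have hcode : MeasurableSet {t : ((ℕ → Bool) × (List Bool → Bool)) × (ℕ → Bool) |
      t.2 ∈ codewords D t.1.2} :=
    (isClosed_codewords.preimage (by fun_prop : Continuous fun t :
      ((ℕ → Bool) × (List Bool → Bool)) × (ℕ → Bool) => (t.1.2, t.2))).measurableSet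
  have hne : MeasurableSet {t : ((ℕ → Bool) × (List Bool → Bool)) × (ℕ → Bool) |
      t.2 ≠ encode D t.1.2 t.1.1} :=
    (isOpen_ne_fun continuous_snd henc).measurableSet
  have hrel : MeasurableSet {t : ((ℕ → Bool) × (List Bool → Bool)) × (ℕ → Bool) |
      Q t.2 (encode D t.1.2 t.1.1)} :=
    (continuous_snd.prodMk henc).measurable hQ
  convert (hcode.inter (hne.inter hrel)).analyticSet_image measurable_fst
  ext p
  simp [dominatedPairs]

theorem coinMeasure_preimage_dominatedPairs (hD : D.Infinite)
    (hQ : MeasurableSet {p : (ℕ → Bool) × (ℕ → Bool) | Q p.1 p.2})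
    (hcount : ∀ y, {x | Q x y}.Countable) (z : ℕ → Bool) :
    coinMeasure (List Bool) (Prod.mk z ⁻¹' dominatedPairs D Q) = 0 := by
  classical
  have hanalytic : AnalyticSet (Prod.mk z ⁻¹' dominatedPairs D Q) :=
    (analyticSet_dominatedPairs hQ).preimage (Continuous.prodMk_right z)
  refine infinitePi_null_of_forall_piecewise_null _ (range (dataPrefix D z))
    (nullMeasurableSet_of_analyticSet hanalytic) fun ω => ?_
  -- Once the hash values used by `z` are fixed to be those of `ω`, so is the codeword of `z`.
  have henc (τ) : encode D ((range (dataPrefix D z)).piecewise ω τ) z = encode D ω z :=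
    encode_congr_hash (piecewise_eqOn _ _ _)
  refine measure_mono_null (t := ⋃ x ∈ {x | Q x (encode D ω z)}, {τ | (∃ n ∉ D, x n ≠ z n) ∧
    x ∈ codewords D ((range (dataPrefix D z)).piecewise ω τ)}) ?_ ?_
  · rintro τ ⟨x, hx, hne, hxz⟩
    simp only [henc] at hne hxz
    refine mem_biUnion hxz ⟨?_, hx⟩
    by_contra! hagree
    refine hne (eq_of_mem_codewords hx (henc τ ▸ encode_mem_codewords) fun n hn => ?_)
    rw [hagree n hn, encode_apply_of_notMem hn]
  · refine (measure_biUnion_null_iff (hcount _)).2 fun x _ => ?_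
    by_cases hx : ∃ n ∉ D, x n ≠ z n
    · obtain ⟨n, hn, hxz⟩ := hx
      exact measure_mono_null (fun _ => And.right)
        (coinMeasure_mem_codewords_piecewise hD hn hxz ω)
    · simp only [hx, false_and, ofPred_false, measure_empty]

theorem exists_hash_ae_notMem_dominatedPairs (hD : D.Infinite)
    (hQ : MeasurableSet {p : (ℕ → Bool) × (ℕ → Bool) | Q p.1 p.2})
    (hcount : ∀ y, {x | Q x y}.Countable) :
    ∃ ω, ∀ᵐ z ∂coinMeasure ℕ, (z, ω) ∉ dominatedPairs D Q := by
  have hnull : ((coinMeasure ℕ).prod (coinMeasure (List Bool))) (dominatedPairs D Q) = 0 :=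
    measure_prod_null_of_ae_null_of_nullMeasurableSet
      (nullMeasurableSet_of_analyticSet (analyticSet_dominatedPairs hQ))
      (.of_forall (coinMeasure_preimage_dominatedPairs hD hQ hcount))
  have hswap := (Measure.measurePreserving_swap (μ := coinMeasure (List Bool))
    (ν := coinMeasure ℕ)).quasiMeasurePreserving.preimage_null hnull
  obtain ⟨ω, hω⟩ := (Measure.measure_ae_null_of_prod_null hswap).exists
  exact ⟨ω, measure_eq_zero_iff_ae_notMem.1 hω⟩

theorem exists_isClosed_isAntichain_map_encode_ne_zero (hD : D.Infinite)
    (hQ : MeasurableSet {p : (ℕ → Bool) × (ℕ → Bool) | Q p.1 p.2})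
    (hcount : ∀ y, {x | Q x y}.Countable) :
    ∃ ω B, IsClosed B ∧ IsAntichain Q B ∧ (coinMeasure ℕ).map (encode D ω) B ≠ 0 := by
  obtain ⟨ω, hω⟩ := exists_hash_ae_notMem_dominatedPairs hD hQ hcount
  obtain ⟨G, hGω, hG, hGnull⟩ := exists_measurable_superset_of_null (ae_iff.1 hω)
  have hGpos : 0 < coinMeasure ℕ Gᶜ := by
    rw [(prob_compl_eq_one_iff hG).2 hGnull]
    exact zero_lt_one
  obtain ⟨K, hKG, hK, hKpos⟩ := hG.compl.exists_lt_isCompact hGpos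
  have hcont : Continuous (encode D ω) := continuous_encode.comp (Continuous.prodMk_right ω)
  have hclosed : IsClosed (encode D ω '' K) := (hK.image hcont).isClosed
  refine ⟨ω, encode D ω '' K, hclosed, ?_, ?_⟩
  · rintro _ ⟨w, -, rfl⟩ _ ⟨z, hz, rfl⟩ hne hwz
    exact hKG hz (hGω (not_not.2 ⟨_, encode_mem_codewords, hne, hwz⟩))
  · rw [Measure.map_apply hcont.measurable hclosed.measurableSet]
    exact (hKpos.trans_le (measure_mono (subset_preimage_image _ _))).ne'

end Relation

theorem map_encode_cylinder_le (ω : List Bool → Bool) (x : ℕ → Bool) (n : ℕ) :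
    (coinMeasure ℕ).map (encode D ω) (PiNat.cylinder x n) ≤
      2⁻¹ ^ ((Finset.range n).filter (· ∉ D)).card := by
  have hcont : Continuous (encode D ω) := continuous_encode.comp (Continuous.prodMk_right ω)
  rw [Measure.map_apply hcont.measurable (PiNat.isOpen_cylinder _ x n).measurableSet,
    ← coinMeasure_pi_singleton _ x]
  refine measure_mono fun z hz i hi => ?_
  obtain ⟨hin, hiD⟩ := Finset.mem_filter.1 hi
  exact (encode_apply_of_notMem hiD).symm.trans (hz i (Finset.mem_range.1 hin))

theorem eventually_mul_le_card_filter_notMem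
    (hD : Tendsto (fun n : ℕ => (((Finset.range n).filter (· ∈ D)).card : ℝ) / n) atTop (𝓝 0))
    {s : ℝ} (hs : s < 1) :
    ∀ᶠ n : ℕ in atTop, n * s ≤ ((Finset.range n).filter (· ∉ D)).card := by
  filter_upwards [hD.eventually_lt_const (sub_pos.2 hs), eventually_gt_atTop 0] with n hn hn0
  have hcheck : (((Finset.range n).filter (· ∈ D)).card : ℝ) < (1 - s) * n :=
    (div_lt_iff₀ (Nat.cast_pos.2 hn0)).1 hn
  have hsum : (((Finset.range n).filter (· ∈ D)).card : ℝ) +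
      ((Finset.range n).filter (· ∉ D)).card = n := by
    exact_mod_cast (Finset.card_filter_add_card_filter_not _).trans (Finset.card_range n)
  linarith

theorem one_le_dimH_of_map_encode_ne_zero
    (hD : Tendsto (fun n : ℕ => (((Finset.range n).filter (· ∈ D)).card : ℝ) / n) atTop (𝓝 0))
    {B : Set (ℕ → Bool)} (hB : (coinMeasure ℕ).map (encode D ω) B ≠ 0) : 1 ≤ dimH B := by
  refine ENNReal.le_of_forall_nnreal_lt fun s hs => ?_
  refine le_dimH_of_measure_cylinder_le hB ?_
  filter_upwards [eventually_mul_le_card_filter_notMem hD (s := s) (by exact_mod_cast hs)]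
    with n hn x
  refine (map_encode_cylinder_le ω x n).trans ?_
  rw [← ENNReal.rpow_natCast, ← ENNReal.rpow_natCast, ← ENNReal.rpow_mul]
  exact ENNReal.rpow_le_rpow_of_exponent_ge (by norm_num) hn

end RandomCode

section Squares

theorem infinite_setOf_isSquare : {n : ℕ | IsSquare n}.Infinite :=
  infinite_of_injective_forall_mem (f := fun k : ℕ => k * k)
    (fun _ _ => Nat.mul_self_inj.1) fun k => ⟨k, rfl⟩

theorem card_filter_isSquare_range_le (n : ℕ) :
    ((Finset.range n).filter IsSquare).card ≤ Nat.sqrt n + 1 := by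
  have hsub : (Finset.range n).filter IsSquare ⊆
      (Finset.range (Nat.sqrt n + 1)).image fun k => k * k := fun i hi => by
    obtain ⟨hin, k, rfl⟩ := Finset.mem_filter.1 hi
    exact Finset.mem_image_of_mem _ (Finset.mem_range_succ_iff.2
      (Nat.le_sqrt.2 (Finset.mem_range.1 hin).le))
  exact (Finset.card_le_card hsub).trans (Finset.card_image_le.trans_eq (Finset.card_range _))

theorem tendsto_card_filter_isSquare_div :
    Tendsto (fun n : ℕ => (((Finset.range n).filter IsSquare).card : ℝ) / n) atTop (𝓝 0) := by
  have hlim : Tendsto (fun n : ℕ => 2 / √(n : ℝ)) atTop (𝓝 0) :=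
    (Real.tendsto_sqrt_atTop.comp tendsto_natCast_atTop_atTop).const_div_atTop 2
  refine squeeze_zero' (.of_forall fun n => by positivity) ?_ hlim
  filter_upwards [eventually_ge_atTop 1] with n hn
  have hsqrt : 1 ≤ √(n : ℝ) := Real.one_le_sqrt.2 (by exact_mod_cast hn)
  have hcard : (((Finset.range n).filter IsSquare).card : ℝ) ≤ 2 * √n := calc
    (((Finset.range n).filter IsSquare).card : ℝ) ≤ Nat.sqrt n + 1 := by
      exact_mod_cast card_filter_isSquare_range_le n
    _ ≤ √n + √n := add_le_add Real.nat_sqrt_le_real_sqrt hsqrt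
    _ = 2 * √n := (two_mul _).symm
  calc (((Finset.range n).filter IsSquare).card : ℝ) / n ≤ 2 * √n / n := by gcongr
    _ = 2 / √n := by rw [mul_div_assoc, Real.sqrt_div_self', mul_one_div]

end Squares

theorem corollary3p4_general (Q : (ℕ → Bool) → (ℕ → Bool) → Prop)
    (hborel : MeasurableSet {p : (ℕ → Bool) × (ℕ → Bool) | Q p.1 p.2})
    (hcount : ∀ y, {x | Q x y}.Countable) :
    ∃ B : Set (ℕ → Bool), IsClosed B ∧ IsAntichain Q B ∧ dimH B = 1 := by
  obtain ⟨ω, B, hclosed, hanti, hB⟩ :=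
    exists_isClosed_isAntichain_map_encode_ne_zero infinite_setOf_isSquare hborel hcount
  exact ⟨B, hclosed, hanti, le_antisymm (cantor_dimH_le_one B)
    (one_le_dimH_of_map_encode_ne_zero (D := {n | IsSquare n}) tendsto_card_filter_isSquare_div hB)⟩

theorem corollary3p4 (Q : (ℕ → Bool) → (ℕ → Bool) → Prop)
    (hQ : IsLocallyCountableBorelQuasiOrder Q) :
    ∃ B : Set (ℕ → Bool), IsClosed B ∧ IsAntichain Q B ∧ dimH B = 1 :=
  corollary3p4_general Q hQ.borel hQ.locallyCountable
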